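/- Let $\mathscr{H}=(\mathbb{C}^2)^{\otimes n}$ be the Hilbert space of $n$ qubits and let $r\ge 0$ be an integer. For a subspace $\mathcal{W}\subseteq\mathscr{H}$ let $P_{\mathcal{W}}$ denote the orthogonal projector onto $\mathcal{W}$, and let $\|\cdot\|_1$ denote the trace norm (the sum of the singular values). For $s\ge 0$ let $\mathcal{P}_s$ be the set of Pauli operators (tensor products of the single-qubit matrices $1,X,Y,Z$) that act non-trivially on at most $s$ qubits, and for a subspace $\mathcal{V}$ let $$\mathcal{B}_s(\mathcal{V})=\operatorname{span}\{S|\psi\rangle : |\psi\rangle\in\mathcal{V},\ S\in\mathcal{P}_s\},\qquad \partial_s\mathcal{V}=\mathcal{B}_s(\mathcal{V})\cap\mathcal{V}^{\perp}.$$ Theorem (Quantum Bottleneck Theorem, local channels). Let $\mathcal{M}$ be an $r$-local quantum channel on $n$ qubits, that is, a completely positive trace-preserving map with a Kraus representation $\mathcal{M}[X]=\sum_i K_iXK_i^\dagger$ in which every Kraus operator $K_i$ acts on at most $r$ qubits (which qubits may depend on $i$). Let $\rho$ be a steady state of $\mathcal{M}$, that is, a density operator with $\mathcal{M}[\rho]=\rho$,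 and let $\mathcal{V}\subseteq\mathscr{H}$ be a subspace with $\operatorname{tr}(P_{\mathcal{V}}\rho)\neq 0$. Put $$\Delta=\frac{\|P_{\partial_{2r}\mathcal{V}}\,\rho\|_1}{\operatorname{tr}(P_{\mathcal{V}}\rho)},\qquad \rho_{\mathcal{V}}=\frac{P_{\mathcal{V}}\,\rho\,P_{\mathcal{V}}}{\operatorname{tr}(P_{\mathcal{V}}\rho)}.$$ Then $$\Delta=\frac{\|\rho\,P_{\partial_{2r}\mathcal{V}}\|_1}{\operatorname{tr}(P_{\mathcal{V}}\rho)}\qquad\text{and}\qquad \|\mathcal{M}[\rho_{\mathcal{V}}]-\rho_{\mathcal{V}}\|_1\le 10\,\Delta .$$ -/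

import Mathlib

noncomputable section

namespace QubitBottleneck

/-- The Hilbert space of `n` qubits, with its computational basis indexed by bit strings. -/
abbrev Hilb (n : ℕ) : Type := EuclideanSpace ℂ (Fin n → Fin 2)

/-- Operators on the Hilbert space of `n` qubits (`*` is composition). -/
abbrev Op (n : ℕ) : Type := Hilb n →L[ℂ] Hilb n

/-- The trace of an operator. -/
def tr {n : ℕ} (X : Op n) : ℂ := LinearMap.trace ℂ (Hilb n) (X : Hilb n →ₗ[ℂ] Hilb n)

/-- The trace norm: the sum of the singular values, counted with multiplicity. -/
def traceNorm {n : ℕ} (X : Op n) : ℝ :=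
  ∑ i ∈ Finset.range (Module.finrank ℂ (Hilb n)),
    (X : Hilb n →ₗ[ℂ] Hilb n).singularValues i

/-- Density operators: positive operators of trace one. -/
structure IsDensityOperator {n : ℕ} (ρ : Op n) : Prop where
  isPositive : ρ.IsPositive
  tr_eq_one : tr ρ = 1

/-- The four single-qubit Pauli matrices `1, X, Y, Z`. -/
def pauli : Fin 4 → Matrix (Fin 2) (Fin 2) ℂ :=
  ![1, !![0, 1; 1, 0], !![0, -Complex.I; Complex.I, 0], !![1, 0; 0, -1]]

/-- The Pauli operator on `n` qubits that acts on qubit `i` by the Pauli matrix with label `s i`,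
that is, the tensor product of these matrices. -/
def pauliString {n : ℕ} (s : Fin n → Fin 4) : Op n :=
  Matrix.toEuclideanCLM (𝕜 := ℂ)
    (Matrix.of fun x y : Fin n → Fin 2 => ∏ i, pauli (s i) (x i) (y i))

/-- The support of a Pauli string: the qubits on which it acts non-trivially. -/
def pauliSupport {n : ℕ} (s : Fin n → Fin 4) : Finset (Fin n) :=
  Finset.univ.filter fun i => s i ≠ 0

/-- The Pauli operators acting on at most `r` qubits. -/
def pauliSet (n r : ℕ) : Set (Op n) :=
  {S | ∃ s : Fin n → Fin 4, (pauliSupport s).card ≤ r ∧ S = pauliString s}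

/-- The `r`-neighborhood of the subspace `V`. -/
def neighborhood {n : ℕ} (r : ℕ) (V : Submodule ℂ (Hilb n)) : Submodule ℂ (Hilb n) :=
  Submodule.span ℂ {φ | ∃ S ∈ pauliSet n r, ∃ ψ ∈ V, φ = S ψ}

/-- The `r`-boundary of `V`: the orthogonal complement of `V` within its `r`-neighborhood. -/
def boundary {n : ℕ} (r : ℕ) (V : Submodule ℂ (Hilb n)) : Submodule ℂ (Hilb n) :=
  neighborhood r V ⊓ Vᗮ

/-- The orthogonal projector onto the subspace `V`. -/
def proj {n : ℕ} (V : Submodule ℂ (Hilb n)) : Op n := V.starProjection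

/-- The operator on `n` qubits that acts as `k` on the qubits in `T` and as the identity on the
others, that is, the tensor product of `k` with the identity. -/
def extend {n : ℕ} (T : Finset (Fin n)) (k : Matrix (T → Fin 2) (T → Fin 2) ℂ) : Op n :=
  Matrix.toEuclideanCLM (𝕜 := ℂ)
    (Matrix.of fun x y : Fin n → Fin 2 =>
      if ∀ i, i ∉ T → x i = y i then k (fun i => x i) (fun i => y i) else 0)

/-- `K` acts on at most `r` qubits. -/
def ActsOnAtMost {n : ℕ} (r : ℕ) (K : Op n) : Prop :=
  ∃ (T : Finset (Fin n)) (k : Matrix (T → Fin 2) (T → Fin 2) ℂ), T.card ≤ r ∧ K = extend T k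

/-- Quantum channels: completely positive, trace-preserving linear maps on operators. -/
structure IsQuantumChannel {n : ℕ} (M : Op n →ₗ[ℂ] Op n) : Prop where
  completelyPositive : ∃ Φ : CompletelyPositiveMap (Op n) (Op n), ∀ X, Φ X = M X
  tr_map : ∀ X, tr (M X) = tr X

/-- `K` is a Kraus representation of `M`. -/
def IsKrausRepresentation {n m : ℕ} (M : Op n →ₗ[ℂ] Op n) (K : Fin m → Op n) : Prop :=
  ∀ X, M X = ∑ i, K i * X * ContinuousLinearMap.adjoint (K i)

/-- `r`-local channels: quantum channels with a Kraus representation in which every Kraus operator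
acts on at most `r` qubits (different Kraus operators may act on different qubits). -/
structure IsLocalChannel {n : ℕ} (r : ℕ) (M : Op n →ₗ[ℂ] Op n) : Prop where
  isQuantumChannel : IsQuantumChannel M
  exists_kraus : ∃ (m : ℕ) (K : Fin m → Op n),
    IsKrausRepresentation M K ∧ ∀ i, ActsOnAtMost r (K i)

/-- A steady state of `M`: a density operator fixed by `M`. -/
structure IsSteadyState {n : ℕ} (M : Op n →ₗ[ℂ] Op n) (ρ : Op n) : Prop where
  isDensityOperator : IsDensityOperator ρ
  map_eq : M ρ = ρ

/-- The projected state `P_V ρ P_V / tr (P_V ρ)`. -/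
def projectedState {n : ℕ} (V : Submodule ℂ (Hilb n)) (ρ : Op n) : Op n :=
  (tr (proj V * ρ))⁻¹ • (proj V * ρ * proj V)

/-- The bottleneck ratio of `V` for `r`-local channels with steady state `ρ`. The trace in the
denominator is a nonnegative real number when `ρ` is positive. -/
def bottleneckRatio {n : ℕ} (r : ℕ) (V : Submodule ℂ (Hilb n)) (ρ : Op n) : ℝ :=
  traceNorm (proj (boundary (2 * r) V) * ρ) / (tr (proj V * ρ)).re

end QubitBottleneck

end

/-!
The idea is to compare both `M (P ρ P)` and `P ρ P` with compressions of `ρ = M ρ`, where `P` is the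
projector onto `V`. Let `R` be the projector onto the `r`-neighborhood of `V`, `D` the projector onto
the `2 * r`-boundary, and `Q = 1 - P - D` the projector onto the complement of the
`2 * r`-neighborhood.

A Kraus operator `K` on `r` qubits maps `V` into the `r`-neighborhood, so `R K P = K P`. Its adjoint
maps the `r`-neighborhood into the `2 * r`-neighborhood, so `R K Q = 0`. Hence
`R K (1 - D) = K P` (`ActsOnAtMost.proj_mul_mul_one_sub_proj`), and summing over the Kraus operators
`M (P ρ P) = R (M ((1 - D) ρ (1 - D))) R` (`map_proj_mul_mul_proj`).

The operator `(1 - D) ρ (1 - D)` differs from `ρ` by at most `2 * ‖D ρ‖₁` in trace norm, and `M`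
contracts the trace norm (`IsKrausRepresentation.traceNorm_map_le`), so `M (P ρ P)` is within
`2 * ‖D ρ‖₁` of `R (M ρ) R = R ρ R`. Finally `R - P` is the projector onto the `r`-boundary, which is
contained in the `2 * r`-boundary, so `R ρ R` is within `2 * ‖D ρ‖₁` of `P ρ P`. Altogether the
constant `4` is enough (`traceNorm_map_proj_sub_le`).

The properties of the trace norm come from its duality with the operator norm: `‖X‖₁` is the maximum
of `‖tr (U X)‖` over the contractions `U` (`norm_tr_mul_le_traceNorm`,
`exists_tr_mul_eq_traceNorm`). The locality of the Kraus operators is used through the expansion of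
operators on `r` qubits in Pauli strings (`ActsOnAtMost.mem_span_pauliSet`) and the subadditivity of
weights under products (`mul_mem_span_pauliSet`).
-/

open scoped InnerProductSpace

namespace QubitBottleneck

variable {n : ℕ}

/-! ### The trace -/

lemma tr_mul_comm (X Y : Op n) : tr (X * Y) = tr (Y * X) :=
  LinearMap.trace_mul_comm ℂ (X : Hilb n →ₗ[ℂ] Hilb n) (Y : Hilb n →ₗ[ℂ] Hilb n)

lemma tr_add (X Y : Op n) : tr (X + Y) = tr X + tr Y := by
  simp [tr]

lemma tr_smul (c : ℂ) (X : Op n) : tr (c • X) = c * tr X := by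
  simp [tr]

lemma tr_sum {ι : Type*} (s : Finset ι) (f : ι → Op n) :
    tr (∑ i ∈ s, f i) = ∑ i ∈ s, tr (f i) := by
  simp [tr, map_sum]

lemma tr_eq_sum_inner {ι : Type*} [Fintype ι] (X : Op n) (b : OrthonormalBasis ι ℂ (Hilb n)) :
    tr X = ∑ i, ⟪b i, X (b i)⟫_ℂ :=
  LinearMap.trace_eq_sum_inner _ b

lemma tr_star (X : Op n) : tr (star X) = star (tr X) := by
  let b := EuclideanSpace.basisFun (Fin n → Fin 2) ℂ
  rw [tr_eq_sum_inner _ b, tr_eq_sum_inner _ b, star_sum]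
  refine Finset.sum_congr rfl fun i _ => ?_
  rw [ContinuousLinearMap.star_eq_adjoint, ContinuousLinearMap.adjoint_inner_right]
  exact (inner_conj_symm _ _).symm

/-- The trace pairing is nondegenerate. -/
lemma eq_of_forall_tr_mul_eq {A B : Op n} (h : ∀ X, tr (A * X) = tr (B * X)) : A = B := by
  refine ContinuousLinearMap.ext fun y => ?_
  refine ext_inner_left ℂ fun x => ?_
  have key : ∀ C : Op n, tr (C * InnerProductSpace.rankOne ℂ y x) = ⟪x, C y⟫_ℂ := by
    intro C
    have : C * InnerProductSpace.rankOne ℂ y x = InnerProductSpace.rankOne ℂ (C y) x := by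
      ext z
      simp
    rw [this]
    exact InnerProductSpace.trace_rankOne _ _
  rw [← key, ← key, h]

/-! ### Duality between the trace norm and the operator norm -/

/-- Right singular vectors: an orthonormal basis which the operator maps to orthogonal vectors
whose lengths are the singular values. -/
lemma exists_singularBasis (X : Op n) :
    ∃ (m : ℕ) (b : OrthonormalBasis (Fin m) ℂ (Hilb n)) (σ : Fin m → ℝ),
      (∀ i, 0 ≤ σ i) ∧ traceNorm X = ∑ i, σ i ∧
      ∀ i j, ⟪X (b i), X (b j)⟫_ℂ = if i = j then ((σ i : ℂ)) ^ 2 else 0 := by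
  let T : Hilb n →ₗ[ℂ] Hilb n := X
  let hs := T.isSymmetric_adjoint_comp_self
  let b := hs.eigenvectorBasis rfl
  refine ⟨_, b, fun i => T.singularValues i, fun i => T.singularValues_nonneg i, ?_, ?_⟩
  · exact Finset.sum_range (fun i => T.singularValues i)
  · intro i j
    have h1 : ⟪T (b i), T (b j)⟫_ℂ = ⟪b i, (T.adjoint ∘ₗ T) (b j)⟫_ℂ := by
      rw [LinearMap.comp_apply, LinearMap.adjoint_inner_right]
    have h2 := hs.apply_eigenvectorBasis rfl j
    change ⟪T (b i), T (b j)⟫_ℂ = _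
    rw [h1]
    erw [h2]
    rw [inner_smul_right, orthonormal_iff_ite.mp b.orthonormal i j]
    split_ifs with hij
    · subst hij
      rw [← T.sq_singularValues_fin rfl]
      simp
    · simp

/-- One half of the duality between the trace norm and the operator norm. -/
lemma norm_tr_mul_le_traceNorm {U : Op n} (hU : ‖U‖ ≤ 1) (X : Op n) :
    ‖tr (U * X)‖ ≤ traceNorm X := by
  obtain ⟨m, b, σ, hσ, hX, hin⟩ := exists_singularBasis X
  have hn : ∀ i, ‖X (b i)‖ = σ i := by
    intro i
    have h := hin i i
    rw [if_pos rfl, inner_self_eq_norm_sq_to_K] at h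
    have h' : ‖X (b i)‖ ^ 2 = σ i ^ 2 := Complex.ofReal_injective (by push_cast; exact h)
    exact (sq_eq_sq₀ (norm_nonneg _) (hσ i)).mp h'
  rw [tr_eq_sum_inner _ b, hX]
  refine (norm_sum_le _ _).trans (Finset.sum_le_sum fun i _ => ?_)
  calc ‖⟪b i, (U * X) (b i)⟫_ℂ‖ ≤ ‖b i‖ * ‖(U * X) (b i)‖ := norm_inner_le_norm _ _
    _ = ‖U (X (b i))‖ := by rw [b.norm_eq_one, one_mul]; rfl
    _ ≤ 1 * ‖X (b i)‖ := U.le_of_opNorm_le hU _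
    _ = σ i := by rw [one_mul, hn]

/-- The supremum in the duality between the trace norm and the operator norm is attained, at the
adjoint of the partial isometry in the polar decomposition. -/
lemma exists_tr_mul_eq_traceNorm (X : Op n) :
    ∃ U : Op n, ‖U‖ ≤ 1 ∧ tr (U * X) = traceNorm X := by
  obtain ⟨m, b, σ, hσ, hX, hin⟩ := exists_singularBasis X
  -- Where `σ i = 0`, the convention `0⁻¹ = 0` removes the term.
  let U : Op n := ∑ i, ((σ i : ℂ))⁻¹ • InnerProductSpace.rankOne ℂ (b i) (X (b i))
  have hUa : ∀ w, U w = ∑ i, (((σ i : ℂ))⁻¹ * ⟪X (b i), w⟫_ℂ) • b i := by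
    intro w
    simp [U, mul_smul]
  refine ⟨U, ?_, ?_⟩
  · refine ContinuousLinearMap.opNorm_le_bound _ zero_le_one fun w => ?_
    rw [one_mul]
    refine le_of_sq_le_sq ?_ (norm_nonneg _)
    have hcoord : ∀ i, ⟪b i, U w⟫_ℂ = ((σ i : ℂ))⁻¹ * ⟪X (b i), w⟫_ℂ := by
      intro i
      rw [hUa, b.orthonormal.inner_right_fintype]
    have horth : Orthonormal ℂ
        (fun i : {i // σ i ≠ 0} => ((σ i : ℂ))⁻¹ • X (b i)) := by
      rw [orthonormal_iff_ite]
      rintro ⟨i, hi⟩ ⟨j, hj⟩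
      rw [inner_smul_left, inner_smul_right, hin]
      have hi' : (σ i : ℂ) ≠ 0 := by exact_mod_cast hi
      by_cases hij : i = j
      · subst hij
        simp
        field_simp
      · simp [hij]
    rw [← b.sum_sq_norm_inner_right (U w)]
    refine le_trans (le_of_eq ?_) (horth.sum_inner_products_le (s := Finset.univ) w)
    rw [← Finset.sum_subtype (Finset.univ.filter fun i => σ i ≠ 0) (by simp)
      (fun i => ‖⟪((σ i : ℂ))⁻¹ • X (b i), w⟫_ℂ‖ ^ 2), Finset.sum_filter_of_ne]
    · refine Finset.sum_congr rfl fun i _ => ?_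
      rw [hcoord, inner_smul_left]
      simp
    · rintro i - hne h0
      simp [h0] at hne
  · rw [tr_eq_sum_inner _ b, hX, Complex.ofReal_sum]
    refine Finset.sum_congr rfl fun i _ => ?_
    change ⟪b i, U (X (b i))⟫_ℂ = _
    rw [hUa, b.orthonormal.inner_right_fintype, hin, if_pos rfl]
    by_cases h0 : σ i = 0
    · simp [h0]
    · have : (σ i : ℂ) ≠ 0 := by exact_mod_cast h0
      field_simp

/-- The other half of the duality: a bound on all pairings with contractions bounds the trace
norm. -/
lemma traceNorm_le_of_forall {X : Op n} {c : ℝ} (h : ∀ U : Op n, ‖U‖ ≤ 1 → ‖tr (U * X)‖ ≤ c) :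
    traceNorm X ≤ c := by
  obtain ⟨U, hU, hUX⟩ := exists_tr_mul_eq_traceNorm X
  have h1 := h U hU
  rw [hUX, Complex.norm_real] at h1
  exact (le_abs_self _).trans h1

/-! ### Elementary properties of the trace norm -/

lemma traceNorm_add_le (X Y : Op n) : traceNorm (X + Y) ≤ traceNorm X + traceNorm Y := by
  refine traceNorm_le_of_forall fun U hU => ?_
  rw [mul_add, tr_add]
  exact (norm_add_le _ _).trans
    (add_le_add (norm_tr_mul_le_traceNorm hU X) (norm_tr_mul_le_traceNorm hU Y))

lemma traceNorm_smul_le (c : ℂ) (X : Op n) : traceNorm (c • X) ≤ ‖c‖ * traceNorm X := by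
  refine traceNorm_le_of_forall fun U hU => ?_
  rw [mul_smul_comm, tr_smul, norm_mul]
  exact mul_le_mul_of_nonneg_left (norm_tr_mul_le_traceNorm hU X) (norm_nonneg c)

lemma traceNorm_neg_le (X : Op n) : traceNorm (-X) ≤ traceNorm X := by
  have h : -X = (-1 : ℂ) • X := by ext; simp
  rw [h]
  simpa only [norm_neg, norm_one, one_mul] using traceNorm_smul_le (-1) X

lemma norm_mul_le_one {A B : Op n} (hA : ‖A‖ ≤ 1) (hB : ‖B‖ ≤ 1) : ‖A * B‖ ≤ 1 :=
  (norm_mul_le A B).trans (mul_le_one₀ hA (norm_nonneg _) hB)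

lemma traceNorm_mul_left_le {A : Op n} (hA : ‖A‖ ≤ 1) (X : Op n) :
    traceNorm (A * X) ≤ traceNorm X := by
  refine traceNorm_le_of_forall fun U hU => ?_
  rw [← mul_assoc]
  exact norm_tr_mul_le_traceNorm (norm_mul_le_one hU hA) X

lemma traceNorm_mul_right_le {A : Op n} (hA : ‖A‖ ≤ 1) (X : Op n) :
    traceNorm (X * A) ≤ traceNorm X := by
  refine traceNorm_le_of_forall fun U hU => ?_
  rw [← mul_assoc, tr_mul_comm, ← mul_assoc]
  exact norm_tr_mul_le_traceNorm (norm_mul_le_one hA hU) X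

lemma traceNorm_star_le (X : Op n) : traceNorm (star X) ≤ traceNorm X := by
  refine traceNorm_le_of_forall fun U hU => ?_
  have h : U * star X = star (X * star U) := by rw [star_mul, star_star]
  rw [h, tr_star, norm_star, tr_mul_comm]
  exact norm_tr_mul_le_traceNorm ((norm_star U).trans_le hU) X

lemma traceNorm_star (X : Op n) : traceNorm (star X) = traceNorm X :=
  le_antisymm (traceNorm_star_le X) (by simpa using traceNorm_star_le (star X))

/-! ### Contractivity of channels -/

section Kraus

variable {m : ℕ} {M : Op n →ₗ[ℂ] Op n} {K : Fin m → Op n}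

/-- A Kraus representation of a trace-preserving map is normalized. -/
lemma IsKrausRepresentation.sum_star_mul_self (hK : IsKrausRepresentation M K)
    (hM : ∀ X, tr (M X) = tr X) : ∑ i, star (K i) * K i = 1 := by
  refine eq_of_forall_tr_mul_eq fun X => ?_
  rw [one_mul, ← hM X, hK X, Finset.sum_mul, tr_sum, tr_sum]
  refine Finset.sum_congr rfl fun i _ => ?_
  rw [← ContinuousLinearMap.star_eq_adjoint, tr_mul_comm _ (star (K i)), mul_assoc]

/-- The map `U ↦ ∑ i, (K i)† U (K i)`, dual to the channel, is a contraction for the operator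
norm. -/
lemma norm_sum_star_mul_mul_le (h1 : ∑ i, star (K i) * K i = 1) {U : Op n} (hU : ‖U‖ ≤ 1) :
    ‖∑ i, star (K i) * U * K i‖ ≤ 1 := by
  have hsum : ∀ x, ∑ i, ‖K i x‖ ^ 2 = ‖x‖ ^ 2 := by
    intro x
    have h2 : ⟪x, (∑ i, star (K i) * K i) x⟫_ℂ = ((∑ i, ‖K i x‖ ^ 2 : ℝ) : ℂ) := by
      rw [sum_apply, inner_sum]
      push_cast
      refine Finset.sum_congr rfl fun i _ => ?_
      change ⟪x, (star (K i)) (K i x)⟫_ℂ = _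
      rw [ContinuousLinearMap.star_eq_adjoint, ContinuousLinearMap.adjoint_inner_right]
      exact inner_self_eq_norm_sq_to_K _
    rw [h1] at h2
    apply Complex.ofReal_injective
    rw [← h2]
    push_cast
    exact inner_self_eq_norm_sq_to_K _
  refine ContinuousLinearMap.opNorm_le_of_re_inner_le zero_le_one fun x y hx hy => ?_
  rw [sum_apply, sum_inner, map_sum]
  calc ∑ i, RCLike.re ⟪(star (K i) * U * K i) x, y⟫_ℂ
      ≤ ∑ i, (‖K i x‖ ^ 2 + ‖K i y‖ ^ 2) / 2 := by
        refine Finset.sum_le_sum fun i _ => ?_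
        have h2 : ⟪(star (K i) * U * K i) x, y⟫_ℂ = ⟪U (K i x), K i y⟫_ℂ := by
          change ⟪(star (K i)) (U (K i x)), y⟫_ℂ = _
          rw [ContinuousLinearMap.star_eq_adjoint, ContinuousLinearMap.adjoint_inner_left]
        have h3 : ‖U (K i x)‖ ≤ ‖K i x‖ := by simpa using U.le_of_opNorm_le hU (K i x)
        have h4 := mul_le_mul_of_nonneg_right h3 (norm_nonneg (K i y))
        rw [h2]
        refine (re_inner_le_norm _ _).trans (h4.trans ?_)
        -- The arithmetic-geometric mean inequality replaces Cauchy–Schwarz for unit vectors.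
        linarith [sq_nonneg (‖K i x‖ - ‖K i y‖)]
    _ = 1 := by
        rw [← Finset.sum_div, Finset.sum_add_distrib, hsum, hsum, hx, hy]
        norm_num

/-- A trace-preserving map with a Kraus representation contracts the trace norm, because its dual
map contracts the operator norm. -/
lemma IsKrausRepresentation.traceNorm_map_le (hK : IsKrausRepresentation M K)
    (hM : ∀ X, tr (M X) = tr X) (X : Op n) : traceNorm (M X) ≤ traceNorm X := by
  refine traceNorm_le_of_forall fun U hU => ?_
  have h : tr (U * M X) = tr ((∑ i, star (K i) * U * K i) * X) := by
    rw [hK X, Finset.sum_mul, Finset.mul_sum, tr_sum, tr_sum]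
    refine Finset.sum_congr rfl fun i _ => ?_
    rw [← ContinuousLinearMap.star_eq_adjoint, ← mul_assoc, tr_mul_comm]
    simp only [mul_assoc]
  rw [h]
  exact norm_tr_mul_le_traceNorm (norm_sum_star_mul_mul_le (hK.sum_star_mul_self hM) hU) X

end Kraus

/-! ### Pauli expansions of local operators -/

/-- The tensor product of the single-qubit matrices `m i`, as an operator on `n` qubits. Its matrix
entries are the products of the entries of the factors. -/
noncomputable def tensorOp (m : Fin n → Matrix (Fin 2) (Fin 2) ℂ) : Op n :=
  Matrix.toEuclideanCLM (𝕜 := ℂ)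
    (Matrix.of fun x y : Fin n → Fin 2 => ∏ i, m i (x i) (y i))

lemma pauliString_eq_tensorOp (s : Fin n → Fin 4) :
    pauliString s = tensorOp fun i => pauli (s i) := rfl

lemma tensorOp_mul (m m' : Fin n → Matrix (Fin 2) (Fin 2) ℂ) :
    tensorOp m * tensorOp m' = tensorOp fun i => m i * m' i := by
  rw [tensorOp, tensorOp, ← map_mul, tensorOp]
  congr 1
  ext x y
  simp only [Matrix.mul_apply, Matrix.of_apply, ← Finset.prod_mul_distrib]
  exact (Fintype.prod_sum fun i z => m i (x i) z * m' i z (y i)).symm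

/-- The Pauli matrices span the single-qubit operators. -/
lemma exists_pauli_coeff (a : Matrix (Fin 2) (Fin 2) ℂ) :
    ∃ c : Fin 4 → ℂ, a = ∑ l, c l • pauli l := by
  refine ⟨![(a 0 0 + a 1 1) / 2, (a 0 1 + a 1 0) / 2, Complex.I * (a 0 1 - a 1 0) / 2,
    (a 0 0 - a 1 1) / 2], ?_⟩
  ext i j
  fin_cases i <;> fin_cases j <;>
    simp [Fin.sum_univ_four, pauli] <;> ring_nf <;> simp <;> ring

/-- A tensor product that is trivial outside `T` is a combination of Pauli strings of weight at
most `T.card`: expand each factor in the Pauli basis; only strings supported in `T` occur. -/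
lemma tensorOp_mem_span (T : Finset (Fin n)) (m : Fin n → Matrix (Fin 2) (Fin 2) ℂ)
    (hm : ∀ i, i ∉ T → m i = 1) : tensorOp m ∈ Submodule.span ℂ (pauliSet n T.card) := by
  have h : ∀ i, ∃ c : Fin 4 → ℂ, m i = ∑ l, c l • pauli l ∧ (i ∉ T → ∀ l, l ≠ 0 → c l = 0) := by
    intro i
    by_cases hi : i ∈ T
    · obtain ⟨c, hc⟩ := exists_pauli_coeff (m i)
      exact ⟨c, hc, fun h => absurd hi h⟩
    · -- Outside `T` only the identity may occur, so the coefficients are fixed explicitly.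
      refine ⟨Pi.single 0 1, ?_, fun _ l hl => by simp [hl]⟩
      rw [hm i hi]
      simp [pauli]
  choose c hc hc0 using h
  have hexp : tensorOp m = ∑ s : Fin n → Fin 4, (∏ i, c i (s i)) • pauliString s := by
    simp only [tensorOp, pauliString, ← map_smul, ← map_sum]
    congr 1
    ext x y
    simp only [Matrix.sum_apply, Matrix.smul_apply, Matrix.of_apply, smul_eq_mul,
      ← Finset.prod_mul_distrib]
    rw [← Fintype.prod_sum fun i l => c i l * pauli l (x i) (y i)]
    refine Finset.prod_congr rfl fun i _ => ?_
    conv_lhs => rw [hc i]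
    simp [Matrix.sum_apply]
  rw [hexp]
  refine Submodule.sum_mem _ fun s _ => ?_
  by_cases hs : pauliSupport s ⊆ T
  · exact Submodule.smul_mem _ _ (Submodule.subset_span ⟨s, Finset.card_le_card hs, rfl⟩)
  · obtain ⟨i, hi, hiT⟩ := Finset.not_subset.mp hs
    rw [Finset.prod_eq_zero (Finset.mem_univ i) (hc0 i hiT (s i) (by simpa [pauliSupport] using hi)),
      zero_smul ℂ (pauliString s)]
    exact Submodule.zero_mem _

lemma pauliSet_mono {r s : ℕ} (h : r ≤ s) : pauliSet n r ⊆ pauliSet n s := by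
  rintro _ ⟨t, ht, rfl⟩
  exact ⟨t, ht.trans h, rfl⟩

lemma one_mem_pauliSet (r : ℕ) : (1 : Op n) ∈ pauliSet n r := by
  refine ⟨fun _ => 0, by simp [pauliSupport], ?_⟩
  rw [pauliString, ← map_one (Matrix.toEuclideanCLM (𝕜 := ℂ) (n := Fin n → Fin 2))]
  congr 1
  ext x y
  simp [pauli, Matrix.one_apply, Finset.prod_ite_zero, funext_iff]

/-- Weights of Pauli operators are subadditive under multiplication. -/
lemma mul_mem_span_pauliSet {r s : ℕ} {A B : Op n} (hA : A ∈ Submodule.span ℂ (pauliSet n r))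
    (hB : B ∈ Submodule.span ℂ (pauliSet n s)) :
    A * B ∈ Submodule.span ℂ (pauliSet n (r + s)) := by
  have h := Submodule.mul_mem_mul hA hB
  rw [Submodule.span_mul_span] at h
  refine Submodule.span_le.mpr ?_ h
  rintro _ ⟨_, ⟨s, hs, rfl⟩, _, ⟨t, ht, rfl⟩, rfl⟩
  -- The product of two Pauli strings is treated as a tensor product that is trivial off the union
  -- of the supports; this avoids tracking phases.
  refine Submodule.span_mono
    (pauliSet_mono ((Finset.card_union_le _ _).trans (add_le_add hs ht)))
    (?_ : pauliString s * pauliString t ∈ _)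
  rw [pauliString_eq_tensorOp, pauliString_eq_tensorOp, tensorOp_mul]
  refine tensorOp_mem_span (pauliSupport s ∪ pauliSupport t) _ fun i hi => ?_
  have hi' : s i = 0 ∧ t i = 0 := by simpa [pauliSupport] using hi
  rw [hi'.1, hi'.2]
  exact mul_one 1

/-- An operator on at most `r` qubits is a combination of Pauli operators of weight at most `r`. -/
lemma ActsOnAtMost.mem_span_pauliSet {r : ℕ} {K : Op n} (hK : ActsOnAtMost r K) :
    K ∈ Submodule.span ℂ (pauliSet n r) := by
  obtain ⟨T, k, hT, rfl⟩ := hK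
  refine Submodule.span_mono (pauliSet_mono hT) ?_
  -- The expansion of `k` in matrix units, each of which is a tensor product.
  have hexp : extend T k = ∑ a : T → Fin 2, ∑ b : T → Fin 2, k a b • tensorOp fun i =>
      if h : i ∈ T then Matrix.single (a ⟨i, h⟩) (b ⟨i, h⟩) 1 else 1 := by
    simp only [tensorOp, extend, ← map_smul, ← map_sum]
    congr 1
    ext x y
    simp only [Matrix.sum_apply, Matrix.smul_apply, Matrix.of_apply, smul_eq_mul]
    have hprod : ∀ a b : T → Fin 2, (∏ i, (if h : i ∈ T then
        Matrix.single (a ⟨i, h⟩) (b ⟨i, h⟩) (1 : ℂ) else 1) (x i) (y i)) =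
        if (a = fun i : T => x i) ∧ (b = fun i : T => y i) ∧ (∀ i, i ∉ T → x i = y i)
        then 1 else 0 := by
      intro a b
      have hfac : ∀ i, (if h : i ∈ T then
        Matrix.single (a ⟨i, h⟩) (b ⟨i, h⟩) (1 : ℂ) else 1) (x i) (y i) =
        if (∀ h : i ∈ T, a ⟨i, h⟩ = x i ∧ b ⟨i, h⟩ = y i) ∧ (i ∉ T → x i = y i)
          then 1 else 0 := by
        intro i
        by_cases h : i ∈ T
        · simp [h, Matrix.single_apply]
        · simp [h, Matrix.one_apply]
      simp only [hfac, Finset.prod_ite_zero, Finset.prod_const_one]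
      refine if_congr ?_ rfl rfl
      simp only [funext_iff, Subtype.forall, Finset.mem_univ, forall_true_left]
      grind
    simp only [hprod]
    simp [ite_and]
  rw [hexp]
  refine Submodule.sum_mem _ fun a _ => Submodule.sum_mem _ fun b _ => Submodule.smul_mem _ _ ?_
  exact tensorOp_mem_span T _ fun i hi => by simp [hi]

lemma ActsOnAtMost.adjoint {r : ℕ} {K : Op n} (hK : ActsOnAtMost r K) :
    ActsOnAtMost r (star K) := by
  obtain ⟨T, k, hT, rfl⟩ := hK
  refine ⟨T, k.conjTranspose, hT, ?_⟩
  rw [extend, ← map_star, extend]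
  congr 1
  ext x y
  simp only [Matrix.star_apply, Matrix.of_apply, Matrix.conjTranspose_apply, eq_comm (a := y _)]
  split_ifs <;> simp

/-! ### Neighborhoods of subspaces -/

lemma le_neighborhood (r : ℕ) (V : Submodule ℂ (Hilb n)) : V ≤ neighborhood r V :=
  fun ψ hψ => Submodule.subset_span ⟨1, one_mem_pauliSet r, ψ, hψ, rfl⟩

lemma neighborhood_mono {r s : ℕ} (h : r ≤ s) (V : Submodule ℂ (Hilb n)) :
    neighborhood r V ≤ neighborhood s V :=
  Submodule.span_mono fun _ ⟨S, hS, ψ, hψ, h'⟩ => ⟨S, pauliSet_mono h hS, ψ, hψ, h'⟩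

lemma apply_mem_neighborhood {r : ℕ} {V : Submodule ℂ (Hilb n)} {A : Op n}
    (hA : A ∈ Submodule.span ℂ (pauliSet n r)) {ψ : Hilb n} (hψ : ψ ∈ V) :
    A ψ ∈ neighborhood r V := by
  induction hA using Submodule.span_induction with
  | mem S hS => exact Submodule.subset_span ⟨S, hS, ψ, hψ, rfl⟩
  | zero => exact Submodule.zero_mem _
  | add A B _ _ hA hB => exact Submodule.add_mem _ hA hB
  | smul c A _ hA => exact Submodule.smul_mem _ c hA

lemma apply_mem_neighborhood_add {r s : ℕ} {V : Submodule ℂ (Hilb n)} {A : Op n}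
    (hA : A ∈ Submodule.span ℂ (pauliSet n r)) {φ : Hilb n} (hφ : φ ∈ neighborhood s V) :
    A φ ∈ neighborhood (r + s) V := by
  induction hφ using Submodule.span_induction with
  | mem φ hφ =>
    obtain ⟨S, hS, ψ, hψ, rfl⟩ := hφ
    exact apply_mem_neighborhood (mul_mem_span_pauliSet hA (Submodule.subset_span hS)) hψ
  | zero => rw [map_zero]; exact Submodule.zero_mem _
  | add φ χ _ _ h h' => rw [map_add]; exact Submodule.add_mem _ h h'
  | smul c φ _ h => rw [map_smul]; exact Submodule.smul_mem _ c h

/-! ### Orthogonal projectors -/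

lemma proj_mul_proj_of_le {W W' : Submodule ℂ (Hilb n)} (h : W ≤ W') :
    proj W * proj W' = proj W :=
  Submodule.starProjection_comp_starProjection_of_le h

lemma star_proj (W : Submodule ℂ (Hilb n)) : star (proj W) = proj W :=
  (isSelfAdjoint_starProjection W).star_eq

lemma norm_proj_le_one (W : Submodule ℂ (Hilb n)) : ‖proj W‖ ≤ 1 :=
  W.starProjection_norm_le

lemma one_sub_proj (W : Submodule ℂ (Hilb n)) : 1 - proj W = proj Wᗮ :=
  (Submodule.starProjection_orthogonal' W).symm

lemma norm_one_sub_proj_le_one (W : Submodule ℂ (Hilb n)) : ‖1 - proj W‖ ≤ 1 := by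
  rw [one_sub_proj]
  exact norm_proj_le_one _

lemma star_one_sub_proj (W : Submodule ℂ (Hilb n)) : star (1 - proj W) = 1 - proj W := by
  rw [one_sub_proj, star_proj]

/-- The `r`-neighborhood is the orthogonal sum of `V` and its `r`-boundary. -/
lemma proj_boundary (r : ℕ) (V : Submodule ℂ (Hilb n)) :
    proj (boundary r V) = proj (neighborhood r V) - proj V := by
  refine ContinuousLinearMap.ext fun u => ?_
  have hV := le_neighborhood r V
  have hR := (neighborhood r V).sub_starProjection_mem_orthogonal u
  have hP := V.sub_starProjection_mem_orthogonal u
  refine (Submodule.eq_starProjection_of_mem_orthogonal (K := boundary r V) ?_ ?_)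
  · refine Submodule.mem_inf.mpr ⟨Submodule.sub_mem _ (Submodule.starProjection_apply_mem _ u)
      (hV (Submodule.starProjection_apply_mem _ u)), ?_⟩
    have h := Submodule.sub_mem _ hP (Submodule.orthogonal_le hV hR)
    rwa [sub_sub_sub_cancel_left] at h
  · have h1 := Submodule.orthogonal_le (inf_le_left : boundary r V ≤ neighborhood r V) hR
    have h2 : V.starProjection u ∈ (boundary r V)ᗮ :=
      Submodule.orthogonal_le (inf_le_right : boundary r V ≤ Vᗮ)
        (V.le_orthogonal_orthogonal (Submodule.starProjection_apply_mem _ u))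
    have h := Submodule.add_mem _ h1 h2
    rwa [sub_add] at h

lemma boundary_mono {r s : ℕ} (h : r ≤ s) (V : Submodule ℂ (Hilb n)) :
    boundary r V ≤ boundary s V :=
  inf_le_inf_right _ (neighborhood_mono h V)

/-! ### Local channels and the boundary -/

/-- An operator on `r` qubits, compressed to the `r`-neighborhood of `V` on the left and to the
complement of the `2 * r`-boundary on the right, only sees `V`: it maps `V` into the
`r`-neighborhood, and its adjoint maps the `r`-neighborhood into the `2 * r`-neighborhood. -/
lemma ActsOnAtMost.proj_mul_mul_one_sub_proj {r : ℕ} {K : Op n} (hK : ActsOnAtMost r K)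
    (V : Submodule ℂ (Hilb n)) :
    proj (neighborhood r V) * K * (1 - proj (boundary (2 * r) V)) = K * proj V := by
  have h1 : proj (neighborhood r V) * K * proj V = K * proj V := by
    refine ContinuousLinearMap.ext fun x => ?_
    exact Submodule.starProjection_eq_self_iff.mpr
      (apply_mem_neighborhood hK.mem_span_pauliSet (Submodule.starProjection_apply_mem V x))
  have h2 : proj (neighborhood (2 * r) V) * star K * proj (neighborhood r V) =
      star K * proj (neighborhood r V) := by
    refine ContinuousLinearMap.ext fun x => ?_
    rw [two_mul]
    exact Submodule.starProjection_eq_self_iff.mpr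
      (apply_mem_neighborhood_add hK.adjoint.mem_span_pauliSet
        (Submodule.starProjection_apply_mem _ x))
  have h3 := congrArg star h2
  simp only [star_mul, star_star, star_proj, ← mul_assoc] at h3
  rw [proj_boundary, mul_sub, mul_one, mul_sub, h3, h1]
  abel

/-- The channel on the projected operator is recovered from the compression of the channel on the
operator with the boundary removed. -/
lemma map_proj_mul_mul_proj {r m : ℕ} {M : Op n →ₗ[ℂ] Op n} {K : Fin m → Op n}
    (hK : IsKrausRepresentation M K) (hr : ∀ i, ActsOnAtMost r (K i))
    (V : Submodule ℂ (Hilb n)) (X : Op n) :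
    M (proj V * X * proj V) =
      proj (neighborhood r V) *
        M ((1 - proj (boundary (2 * r) V)) * X * (1 - proj (boundary (2 * r) V))) *
          proj (neighborhood r V) := by
  rw [hK, hK, Finset.mul_sum, Finset.sum_mul]
  refine Finset.sum_congr rfl fun i _ => ?_
  have h := (hr i).proj_mul_mul_one_sub_proj V
  have h' := congrArg star h
  simp only [star_mul, star_one_sub_proj, star_proj] at h'
  rw [← ContinuousLinearMap.star_eq_adjoint]
  calc K i * (proj V * X * proj V) * star (K i)
      = (K i * proj V) * X * (proj V * star (K i)) := by simp only [mul_assoc]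
    _ = _ := by rw [← h, ← h']; simp only [mul_assoc]

lemma traceNorm_mul_proj_eq {ρ : Op n} (hρ : star ρ = ρ) (W : Submodule ℂ (Hilb n)) :
    traceNorm (ρ * proj W) = traceNorm (proj W * ρ) := by
  rw [← traceNorm_star, star_mul, star_proj, hρ]

/-- The estimate before normalization. With `R` the projector onto the `r`-neighborhood, `D` the
projector onto the `2 * r`-boundary and `E = R - P`, deleting the boundary part of `ρ` costs
`2 * ‖D ρ‖₁`, and so does the replacement of `R ρ R` by `P ρ P`, because `E = E D = D E`. -/
lemma traceNorm_map_proj_sub_le {r m : ℕ} {M : Op n →ₗ[ℂ] Op n} {K : Fin m → Op n}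
    (hK : IsKrausRepresentation M K) (hr : ∀ i, ActsOnAtMost r (K i))
    (htr : ∀ X, tr (M X) = tr X) {ρ : Op n} (hρ : star ρ = ρ) (hfix : M ρ = ρ)
    (V : Submodule ℂ (Hilb n)) :
    traceNorm (M (proj V * ρ * proj V) - proj V * ρ * proj V) ≤
      4 * traceNorm (proj (boundary (2 * r) V) * ρ) := by
  set P := proj V
  set R := proj (neighborhood r V)
  set D := proj (boundary (2 * r) V)
  set E := proj (boundary r V)
  have hle : boundary r V ≤ boundary (2 * r) V := boundary_mono (by omega) V
  have hR1 : ‖R‖ ≤ 1 := norm_proj_le_one _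
  have hP1 : ‖P‖ ≤ 1 := norm_proj_le_one _
  have hE1 : ‖E‖ ≤ 1 := norm_proj_le_one _
  have hDc : ‖1 - D‖ ≤ 1 := norm_one_sub_proj_le_one _
  have hED : E * D = E := proj_mul_proj_of_le hle
  have hDE : D * E = E := by
    have h := congrArg star hED
    rwa [star_mul, star_proj, star_proj] at h
  have hER : E = R - P := proj_boundary r V
  have hρD : traceNorm (ρ * D) = traceNorm (D * ρ) := traceNorm_mul_proj_eq hρ _
  have hdecomp : M (P * ρ * P) - P * ρ * P =
      R * M (-(D * ρ + (1 - D) * (ρ * D))) * R + (R * (ρ * D) * E + E * (D * ρ) * P) := by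
    have e1 : (1 - D) * ρ * (1 - D) = ρ + -(D * ρ + (1 - D) * (ρ * D)) := by
      simp only [mul_sub, sub_mul, one_mul, mul_one, mul_assoc]
      abel
    have e2 : R * (ρ * D) * E + E * (D * ρ) * P = R * ρ * R - P * ρ * P := by
      calc R * (ρ * D) * E + E * (D * ρ) * P = R * ρ * (D * E) + (E * D) * ρ * P := by
            simp only [mul_assoc]
        _ = _ := by
            rw [hDE, hED, hER]
            simp only [mul_sub, sub_mul, mul_assoc]
            abel
    rw [map_proj_mul_mul_proj hK hr V ρ, e2]
    change R * M ((1 - D) * ρ * (1 - D)) * R - _ = _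
    rw [e1, map_add, hfix, mul_add, add_mul]
    abel
  have b1 : traceNorm (R * M (-(D * ρ + (1 - D) * (ρ * D))) * R) ≤ 2 * traceNorm (D * ρ) := by
    refine (traceNorm_mul_right_le hR1 _).trans ((traceNorm_mul_left_le hR1 _).trans
      ((hK.traceNorm_map_le htr _).trans ((traceNorm_neg_le _).trans
      ((traceNorm_add_le _ _).trans ?_))))
    linarith [traceNorm_mul_left_le hDc (ρ * D)]
  have b2 : traceNorm (R * (ρ * D) * E) ≤ traceNorm (D * ρ) :=
    (traceNorm_mul_right_le hE1 _).trans ((traceNorm_mul_left_le hR1 _).trans hρD.le)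
  have b3 : traceNorm (E * (D * ρ) * P) ≤ traceNorm (D * ρ) :=
    (traceNorm_mul_right_le hP1 _).trans (traceNorm_mul_left_le hE1 _)
  rw [hdecomp]
  refine (traceNorm_add_le _ _).trans ?_
  linarith [traceNorm_add_le (R * (ρ * D) * E) (E * (D * ρ) * P)]

lemma traceNorm_nonneg (X : Op n) : 0 ≤ traceNorm X :=
  Finset.sum_nonneg fun i _ => LinearMap.singularValues_nonneg _ i

open scoped ComplexOrder in
lemma tr_proj_mul_nonneg {ρ : Op n} (hρ : ρ.IsPositive) (V : Submodule ℂ (Hilb n)) :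
    0 ≤ tr (proj V * ρ) := by
  have h : tr (proj V * ρ) = tr (proj V * ρ * proj V) := by
    rw [tr_mul_comm (proj V * ρ), ← mul_assoc, proj_mul_proj_of_le le_rfl]
  rw [h]
  exact (hρ.conj_starProjection V).toLinearMap.trace_nonneg

end QubitBottleneck

theorem theorem3 (n r : ℕ)
    (M : QubitBottleneck.Op n →ₗ[ℂ] QubitBottleneck.Op n)
    (hM : QubitBottleneck.IsLocalChannel r M)
    (ρ : QubitBottleneck.Op n) (hρ : QubitBottleneck.IsSteadyState M ρ)
    (V : Submodule ℂ (QubitBottleneck.Hilb n))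
    (hV : QubitBottleneck.tr (QubitBottleneck.proj V * ρ) ≠ 0) :
    QubitBottleneck.bottleneckRatio r V ρ =
        QubitBottleneck.traceNorm
            (ρ * QubitBottleneck.proj (QubitBottleneck.boundary (2 * r) V)) /
          (QubitBottleneck.tr (QubitBottleneck.proj V * ρ)).re ∧
      QubitBottleneck.traceNorm
          (M (QubitBottleneck.projectedState V ρ) - QubitBottleneck.projectedState V ρ) ≤
        10 * QubitBottleneck.bottleneckRatio r V ρ := by
  obtain ⟨⟨-, htr⟩, m, K, hK, hr⟩ := hM
  obtain ⟨⟨hpos, -⟩, hfix⟩ := hρ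
  have hstar : star ρ = ρ := hpos.isSelfAdjoint.star_eq
  refine ⟨?_, ?_⟩
  · rw [QubitBottleneck.traceNorm_mul_proj_eq hstar]
    rfl
  · have hnn := QubitBottleneck.tr_proj_mul_nonneg hpos V
    have hmain := QubitBottleneck.traceNorm_map_proj_sub_le hK hr htr hstar hfix V
    unfold QubitBottleneck.projectedState QubitBottleneck.bottleneckRatio
    set t := QubitBottleneck.tr (QubitBottleneck.proj V * ρ)
    have hδ := QubitBottleneck.traceNorm_nonneg
      (QubitBottleneck.proj (QubitBottleneck.boundary (2 * r) V) * ρ)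
    have hnorm : ‖t⁻¹‖ = t.re⁻¹ := by
      rw [norm_inv, Complex.re_eq_norm.mpr hnn]
    have hre : 0 ≤ t.re⁻¹ := hnorm ▸ norm_nonneg _
    rw [map_smul]
    refine (congrArg QubitBottleneck.traceNorm (smul_sub t⁻¹ _ _).symm).trans_le ?_
    refine (QubitBottleneck.traceNorm_smul_le _ _).trans ?_
    rw [hnorm]
    refine (mul_le_mul_of_nonneg_left hmain hre).trans ?_
    rw [div_eq_mul_inv]
    nlinarith [mul_nonneg hδ hre]
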